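/- Let $R$ be an associative unital ring. A right $R$-module is called countably presentable if it is the cokernel of a homomorphism of free right $R$-modules with at most countable bases. Assume that $R$ is right countably coherent, i.e., every finitely generated right ideal of $R$ is countably presentable as a right $R$-module. Call a right $R$-module $M$ flatly coresolved if there is an exact sequence of right $R$-modules $$0\longrightarrow M\longrightarrow F^0\longrightarrow F^1\longrightarrow F^2\longrightarrow\cdots$$ in which every $F^n$, $n\ge 0$, is flat. Then every flatly coresolved right $R$-module $M$ is the colimit, in the category of right $R$-modules, of a diagram indexed by an $\aleph_1$-directed poset (a poset in which every at most countable subset has an upper bound) all of whose terms are countably presentable flatly coresolved right $R$-modules. -/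

import Mathlib

open CategoryTheory CategoryTheory.Limits
open scoped TensorProduct MulOpposite

universe u

noncomputable section

/-- The subgroup of `M ⊗[ℤ] N` generated by the differences `(m · r) ⊗ n - m ⊗ (r · n)`,
for a right `R`-module `M` (that is, an `Rᵐᵒᵖ`-module) and a left `R`-module `N`. -/
def balancedRelations (R M N : Type u) [Ring R] [AddCommGroup M] [Module Rᵐᵒᵖ M]
    [AddCommGroup N] [Module R N] : Submodule ℤ (M ⊗[ℤ] N) :=
  Submodule.span ℤ {x | ∃ (m : M) (r : R) (n : N),
    x = (MulOpposite.op r • m) ⊗ₜ[ℤ] n - m ⊗ₜ[ℤ] (r • n)}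

/-- The tensor product `M ⊗_R N` of a right module `M` and a left module `N` over a
not necessarily commutative ring `R`; it is an abelian group. -/
abbrev BalancedTensor (R M N : Type u) [Ring R] [AddCommGroup M] [Module Rᵐᵒᵖ M]
    [AddCommGroup N] [Module R N] : Type u :=
  (M ⊗[ℤ] N) ⧸ balancedRelations R M N

theorem balancedRelations_le_comap (R M N N' : Type u) [Ring R] [AddCommGroup M]
    [Module Rᵐᵒᵖ M] [AddCommGroup N] [Module R N] [AddCommGroup N'] [Module R N']
    (f : N →ₗ[R] N') :
    balancedRelations R M N ≤
      (balancedRelations R M N').comap (LinearMap.lTensor M f.toAddMonoidHom.toIntLinearMap) := by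
  refine Submodule.span_le.2 ?_
  rintro x ⟨m, r, n, rfl⟩
  refine Submodule.subset_span ⟨m, r, f n, ?_⟩
  simp

/-- The homomorphism `M ⊗_R N → M ⊗_R N'` induced by an `R`-linear map `N → N'`. -/
def BalancedTensor.lTensor (R M : Type u) {N N' : Type u} [Ring R] [AddCommGroup M]
    [Module Rᵐᵒᵖ M] [AddCommGroup N] [Module R N] [AddCommGroup N'] [Module R N']
    (f : N →ₗ[R] N') : BalancedTensor R M N →ₗ[ℤ] BalancedTensor R M N' :=
  Submodule.mapQ _ _ (LinearMap.lTensor M f.toAddMonoidHom.toIntLinearMap)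
    (balancedRelations_le_comap R M N N' f)

/-- A right `R`-module `M` is flat if `M ⊗_R -` takes injective maps of left `R`-modules to
injective maps. -/
def IsFlatRightModule (R M : Type u) [Ring R] [AddCommGroup M] [Module Rᵐᵒᵖ M] : Prop :=
  ∀ (N N' : Type u) [AddCommGroup N] [Module R N] [AddCommGroup N'] [Module R N']
    (f : N →ₗ[R] N'), Function.Injective f →
      Function.Injective (BalancedTensor.lTensor R M f)

/-- An `A`-module is countably presentable if it is the cokernel of a homomorphism of free
`A`-modules with (at most) countable bases. -/
def IsCountablyPresentable (A M : Type u) [Ring A] [AddCommGroup M] [Module A M] : Prop :=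
  ∃ (ι κ : Type) (_ : Countable ι) (_ : Countable κ)
    (f : (κ →₀ A) →ₗ[A] (ι →₀ A)) (g : (ι →₀ A) →ₗ[A] M),
      Function.Exact f g ∧ Function.Surjective g

/-- A ring is right countably coherent if every finitely generated right ideal is countably
presentable as a right module. -/
def IsRightCountablyCoherent (R : Type u) [Ring R] : Prop :=
  ∀ I : Submodule Rᵐᵒᵖ R, I.FG → IsCountablyPresentable Rᵐᵒᵖ I

/-- A right `R`-module `M` is flatly coresolved if there is an exact sequence
`0 → M → F⁰ → F¹ → F² → ⋯` of right `R`-modules with all `Fⁿ` flat. -/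
def IsFlatlyCoresolved (R : Type u) [Ring R] (M : ModuleCat.{u} Rᵐᵒᵖ) : Prop :=
  ∃ (F : ℕ → ModuleCat.{u} Rᵐᵒᵖ) (ε : M →ₗ[Rᵐᵒᵖ] F 0)
    (d : ∀ n : ℕ, F n →ₗ[Rᵐᵒᵖ] F (n + 1)),
      (∀ n, IsFlatRightModule R (F n)) ∧
      Function.Injective ε ∧
      Function.Exact ε (d 0) ∧
      ∀ n, Function.Exact (d n) (d (n + 1))

/-- A poset is `ℵ₁`-directed if every subset of cardinality less than `ℵ₁` has an upper bound. -/
def IsAlephOneDirected (J : Type u) [PartialOrder J] : Prop :=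
  ∀ S : Set J, S.Countable → BddAbove S

end

/-! Cover each `F n` by the free module whose basis is the set `F n`. An approximation chooses, in
every degree, countably many basis elements and a countably generated module of relations among them
that hold in `F n`; the resulting quotients map to the `F n`. A Löwenheim–Skolem closing-off
argument (`IsSmall.exists_absorbs`, iterated in `IsSmall.exists_absorbs_self`) enlarges any such
choice to one whose quotients form a complex of flat modules exact in positive degrees.

Coherence makes kernels of maps out of free modules of countable rank countably generated when the
target is free or a quotient of a free module by a countably generated submodule
(`HasCountablyGeneratedKernels`). Hence only countably many cocycles must be made coboundaries at
each stage, and the degree zero cocycles are countably presentable. Flatness is controlled by an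
equational criterion (`IsFlatRightModule.exists_lift` and its converse
`isFlatRightModule_of_exists_lift`), whose witnesses can be added countably many at a time.

The closed choices form an `ℵ₁`-directed poset, because a countable join can be closed off again.
Every element and every relation in `F 0` occurs in some closed choice, so the degree zero cocycles
have colimit `ker (d 0) ≅ M`. -/

/-! ### Countably generated submodules -/

namespace Submodule

variable {A : Type*} [Ring A] {P Q : Type*} [AddCommGroup P] [Module A P]
  [AddCommGroup Q] [Module A Q]

/-- A submodule is countably generated if it is spanned by a countable set. -/
def CountablyGenerated (N : Submodule A P) : Prop :=
  ∃ s : Set P, s.Countable ∧ span A s = N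

theorem CountablyGenerated.of_set {s : Set P} (hs : s.Countable) :
    (span A s).CountablyGenerated := ⟨s, hs, rfl⟩

theorem CountablyGenerated.bot : (⊥ : Submodule A P).CountablyGenerated :=
  ⟨∅, Set.countable_empty, span_empty⟩

theorem CountablyGenerated.map {N : Submodule A P} (hN : N.CountablyGenerated) (f : P →ₗ[A] Q) :
    (N.map f).CountablyGenerated := by
  obtain ⟨s, hs, rfl⟩ := hN
  exact ⟨f '' s, hs.image f, span_image f⟩

theorem CountablyGenerated.iSup {ι : Sort*} [Countable ι] {N : ι → Submodule A P}
    (hN : ∀ i, (N i).CountablyGenerated) : (⨆ i, N i).CountablyGenerated := by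
  choose s hs h using hN
  exact ⟨⋃ i, s i, Set.countable_iUnion hs, by rw [span_iUnion]; simp [h]⟩

theorem CountablyGenerated.sup {N N' : Submodule A P} (hN : N.CountablyGenerated)
    (hN' : N'.CountablyGenerated) : (N ⊔ N').CountablyGenerated := by
  obtain ⟨s, hs, rfl⟩ := hN
  obtain ⟨t, ht, rfl⟩ := hN'
  exact ⟨s ∪ t, hs.union ht, span_union s t⟩

theorem CountablyGenerated.supported {ι : Type*} {S : Set ι} (hS : S.Countable) :
    (Finsupp.supported A A S).CountablyGenerated :=
  ⟨(fun i => Finsupp.single i 1) '' S, hS.image _, (Finsupp.supported_eq_span_single A S).symm⟩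

theorem CountablyGenerated.top_finsupp {ι : Type*} [Countable ι] :
    (⊤ : Submodule A (ι →₀ A)).CountablyGenerated := by
  rw [← Finsupp.supported_univ]
  exact CountablyGenerated.supported Set.countable_univ

theorem CountablyGenerated.range {ι : Type*} [Countable ι] (f : (ι →₀ A) →ₗ[A] P) :
    (LinearMap.range f).CountablyGenerated := by
  rw [LinearMap.range_eq_map]
  exact CountablyGenerated.top_finsupp.map f

theorem CountablyGenerated.exists_range_eq {N : Submodule A P} (hN : N.CountablyGenerated) :
    ∃ g : (ℕ →₀ A) →ₗ[A] P, LinearMap.range g = N := by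
  obtain ⟨s, hs, rfl⟩ := hN
  obtain ⟨f, hf⟩ := (hs.insert 0).exists_eq_range (Set.insert_nonempty 0 s)
  exact ⟨Finsupp.linearCombination A f, by
    rw [Finsupp.range_linearCombination, ← hf, span_insert_zero]⟩

end Submodule

/-! ### Countably generated kernels -/

section Coherence

open Submodule

variable {A : Type*} [Ring A]

/-- Every homomorphism from a free module of countable rank to `N` has countably generated
kernel. -/
def HasCountablyGeneratedKernels (A N : Type*) [Ring A] [AddCommGroup N] [Module A N] : Prop :=
  ∀ f : (ℕ →₀ A) →ₗ[A] N, (LinearMap.ker f).CountablyGenerated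

variable {P N N' : Type*} [AddCommGroup P] [Module A P] [AddCommGroup N] [Module A N]
  [AddCommGroup N'] [Module A N']

theorem HasCountablyGeneratedKernels.inf_ker (hN : HasCountablyGeneratedKernels A N)
    {Z : Submodule A P} (hZ : Z.CountablyGenerated) (f : P →ₗ[A] N) :
    (Z ⊓ LinearMap.ker f).CountablyGenerated := by
  obtain ⟨g, rfl⟩ := hZ.exists_range_eq
  have : LinearMap.range g ⊓ LinearMap.ker f = (LinearMap.ker (f ∘ₗ g)).map g := by
    rw [LinearMap.ker_comp, Submodule.map_comap_eq]
  rw [this]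
  exact (hN _).map g

theorem HasCountablyGeneratedKernels.of_injective (hN : HasCountablyGeneratedKernels A N')
    (i : N →ₗ[A] N') (hi : Function.Injective i) : HasCountablyGeneratedKernels A N := by
  intro f
  rw [← LinearMap.ker_comp_of_ker_eq_bot f (LinearMap.ker_eq_bot.2 hi)]
  exact hN _

/-- Lift `f` to `g` with values in `N` and cover `T` by a free module through `t`. The kernel of `f`
is the first projection of the pairs with `g x = t y`, and these are the kernel of a map from a free
module of countable rank to `N`. -/
theorem HasCountablyGeneratedKernels.quotient (hN : HasCountablyGeneratedKernels A N)
    {T : Submodule A N} (hT : T.CountablyGenerated) :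
    HasCountablyGeneratedKernels A (N ⧸ T) := by
  intro f
  obtain ⟨t, rfl⟩ := hT.exists_range_eq
  obtain ⟨g, hg⟩ := Module.projective_lifting_property (LinearMap.range t).mkQ f
    (Submodule.mkQ_surjective _)
  have htop : (⊤ : Submodule A ((ℕ →₀ A) × (ℕ →₀ A))).CountablyGenerated := by
    rw [← LinearMap.sup_range_inl_inr]
    exact (CountablyGenerated.range _).sup (CountablyGenerated.range _)
  have := (hN.inf_ker htop (g ∘ₗ LinearMap.fst A _ _ - t ∘ₗ LinearMap.snd A _ _)).map
    (LinearMap.fst A _ _)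
  convert this using 1
  ext x
  rw [LinearMap.mem_ker, ← hg, LinearMap.comp_apply, Submodule.mkQ_apply,
    Submodule.Quotient.mk_eq_zero]
  simp [sub_eq_zero, @eq_comm _ (g x)]

theorem ker_eq_iSup_inf_supported (f : (ℕ →₀ A) →ₗ[A] N) :
    LinearMap.ker f = ⨆ n, Finsupp.supported A A (Set.Iio n) ⊓ LinearMap.ker f := by
  refine le_antisymm (fun x hx => ?_) (iSup_le fun n => inf_le_right)
  refine Submodule.mem_iSup_of_mem (x.support.sup id + 1) ⟨?_, hx⟩
  refine (Finsupp.mem_supported A x).2 fun i hi => ?_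
  exact Nat.lt_succ_of_le (Finset.le_sup (f := id) hi)

/-- A free submodule on finitely many basis vectors has image in finitely many coordinates, so its
part of the kernel is cut out by finitely many maps to `A`, imposed one at a time. The whole kernel
is a countable union of such parts. -/
theorem HasCountablyGeneratedKernels.finsupp (hA : HasCountablyGeneratedKernels A A)
    (ι : Type*) : HasCountablyGeneratedKernels A (ι →₀ A) := by
  classical
  have key (Z : Submodule A (ℕ →₀ A)) (hZ : Z.CountablyGenerated) (f : (ℕ →₀ A) →ₗ[A] ι →₀ A)
      (E : Finset ι) :
      (Z ⊓ ⨅ e ∈ E, LinearMap.ker (Finsupp.lapply e ∘ₗ f)).CountablyGenerated := by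
    induction E using Finset.induction_on with
    | empty => simpa using hZ
    | insert e E he ih =>
      rw [Finset.iInf_insert, inf_comm (LinearMap.ker _), ← inf_assoc]
      exact hA.inf_ker ih _
  intro f
  rw [ker_eq_iSup_inf_supported]
  refine CountablyGenerated.iSup fun n => ?_
  have hZ := CountablyGenerated.supported (A := A) (Set.to_countable (Set.Iio n))
  set E : Finset ι := (Finset.range n).biUnion fun i => (f (Finsupp.single i 1)).support
  have hE : (Finsupp.supported A A (Set.Iio n)).map f ≤
      Finsupp.supported A A (E : Set ι) := by
    rw [Finsupp.supported_eq_span_single A (Set.Iio n), Submodule.map_span, Submodule.span_le]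
    rintro _ ⟨_, ⟨i, hi, rfl⟩, rfl⟩
    refine (Finsupp.mem_supported A _).2 fun e he => ?_
    exact Finset.mem_coe.2 (Finset.mem_biUnion.2 ⟨i, Finset.mem_range.2 hi, he⟩)
  convert key _ hZ f E using 1
  ext x
  simp only [Submodule.mem_inf, Submodule.mem_iInf, LinearMap.mem_ker, LinearMap.comp_apply,
    Finsupp.lapply_apply, and_congr_right_iff]
  refine fun hx => ⟨fun h e _ => by rw [h, Finsupp.zero_apply], fun h => Finsupp.ext fun e => ?_⟩
  by_cases he : e ∈ E
  · exact h e he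
  · exact Finsupp.notMem_support_iff.1 fun h' =>
      he ((Finsupp.mem_supported A _).1 (hE (Submodule.mem_map_of_mem hx)) h')

end Coherence

/-! ### Countable presentability and kernels -/

section Presentable

open Submodule

variable {A : Type u} [Ring A] {P : Type*} {N : Type u} [AddCommGroup P] [Module A P]
  [AddCommGroup N] [Module A N]

/-- A Schanuel-type argument: lift the cover `f ∘ₗ q` and the given presentation `g` through each
other. The kernel is generated by the transported relations of `g` together with the errors `q - q
∘ₗ k ∘ₗ y` of the round trip. -/
theorem IsCountablyPresentable.countablyGenerated_ker (hN : IsCountablyPresentable A N)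
    {Z : Submodule A P} (hZ : Z.CountablyGenerated) (f : P →ₗ[A] N)
    (hf : Z.map f = ⊤) : (Z ⊓ LinearMap.ker f).CountablyGenerated := by
  obtain ⟨ι, κ, _, _, h, g, hgh, hg⟩ := hN
  obtain ⟨q, rfl⟩ := hZ.exists_range_eq
  have hfq : Function.Surjective (f ∘ₗ q) := by
    rw [← LinearMap.range_eq_top, LinearMap.range_comp, hf]
  obtain ⟨y, hy⟩ := Module.projective_lifting_property g (f ∘ₗ q) hg
  obtain ⟨k, hk⟩ := Module.projective_lifting_property (f ∘ₗ q) g hfq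
  replace hy (v) : g (y v) = f (q v) := LinearMap.congr_fun hy v
  replace hk (v) : f (q (k v)) = g v := LinearMap.congr_fun hk v
  have : LinearMap.range q ⊓ LinearMap.ker f =
      LinearMap.range (q ∘ₗ k ∘ₗ h) ⊔ LinearMap.range (q - q ∘ₗ k ∘ₗ y) := by
    apply le_antisymm
    · rintro _ ⟨⟨v, rfl⟩, hv⟩
      obtain ⟨w, hw⟩ := (hgh (y v)).1 (by rw [hy]; exact hv)
      refine Submodule.mem_sup.2 ⟨q (k (h w)), ⟨w, rfl⟩, q v - q (k (y v)), ⟨v, rfl⟩, ?_⟩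
      rw [hw, add_sub_cancel]
    · refine sup_le ?_ ?_
      · rintro _ ⟨w, rfl⟩
        exact ⟨⟨_, rfl⟩, (hk _).trans (hgh.apply_apply_eq_zero w)⟩
      · rintro _ ⟨v, rfl⟩
        refine ⟨⟨v - k (y v), by simp⟩, ?_⟩
        simp [hk, hy]
  rw [this]
  exact (CountablyGenerated.range _).sup (CountablyGenerated.range _)

theorem HasCountablyGeneratedKernels.isCountablyPresentable
    (hN : HasCountablyGeneratedKernels A N) (h : (⊤ : Submodule A N).CountablyGenerated) :
    IsCountablyPresentable A N := by
  obtain ⟨g, hg⟩ := h.exists_range_eq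
  obtain ⟨f, hf⟩ := (hN g).exists_range_eq
  exact ⟨ℕ, ℕ, inferInstance, inferInstance, f, g, LinearMap.exact_iff.2 hf.symm,
    LinearMap.range_eq_top.1 hg⟩

end Presentable

/-! ### Consequences of right countable coherence -/

section RightCoherent

open Submodule

variable {R : Type u} [Ring R]

/-- On each finite-rank free submodule the image of `f` is a finitely generated right ideal, to
which coherence applies; the kernel is the countable union of the kernels obtained. -/
theorem IsRightCountablyCoherent.hasCountablyGeneratedKernels (hR : IsRightCountablyCoherent R) :
    HasCountablyGeneratedKernels Rᵐᵒᵖ Rᵐᵒᵖ := by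
  have hR' : HasCountablyGeneratedKernels Rᵐᵒᵖ R := by
    intro f
    rw [ker_eq_iSup_inf_supported]
    refine CountablyGenerated.iSup fun n => ?_
    set Z := Finsupp.supported Rᵐᵒᵖ Rᵐᵒᵖ (Set.Iio n) with hZdef
    have hZ : Z.FG := by
      rw [hZdef, Finsupp.supported_eq_span_single]
      exact Submodule.fg_span ((Set.finite_Iio n).image _)
    let f' : Z →ₗ[Rᵐᵒᵖ] Z.map f := f.submoduleMap Z
    have hZ' : Submodule.CountablyGenerated (A := Rᵐᵒᵖ) (P := Z) ⊤ := by
      obtain ⟨s, hs⟩ := (Submodule.fg_top Z).2 hZ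
      exact ⟨s, s.countable_toSet, hs⟩
    have := ((hR _ (hZ.map f)).countablyGenerated_ker hZ' f' (by
      rw [← LinearMap.range_eq_map, LinearMap.range_eq_top]
      exact f.submoduleMap_surjective Z)).map Z.subtype
    convert this using 1
    ext x
    simp [f', Subtype.ext_iff, and_comm]
  refine hR'.of_injective
    { toFun := MulOpposite.unop, map_add' := fun _ _ => rfl, map_smul' := fun _ _ => rfl }
    MulOpposite.unop_injective

end RightCoherent

/-! ### The equational criterion for flatness -/

section Flat

variable {R : Type u} [Ring R]

namespace BalancedTensor

variable {M N N' : Type u} [AddCommGroup M] [Module Rᵐᵒᵖ M]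
  [AddCommGroup N] [Module R N] [AddCommGroup N'] [Module R N']

/-- The class of a pure tensor. -/
noncomputable def tmul (R : Type u) [Ring R] {M N : Type u} [AddCommGroup M] [Module Rᵐᵒᵖ M]
    [AddCommGroup N] [Module R N] : M →+ N →+ BalancedTensor R M N where
  toFun m :=
    { toFun := fun n => Submodule.Quotient.mk (m ⊗ₜ[ℤ] n)
      map_zero' := by simp
      map_add' := fun _ _ => by rw [TensorProduct.tmul_add, Submodule.Quotient.mk_add] }
  map_zero' := by ext; simp
  map_add' _ _ := by ext; simp [TensorProduct.add_tmul]

theorem tmul_smul (m : M) (r : R) (n : N) :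
    tmul R m (r • n) = tmul R (MulOpposite.op r • m) n :=
  ((Submodule.Quotient.eq (balancedRelations R M N)).2
    (Submodule.subset_span ⟨m, r, n, rfl⟩)).symm

@[elab_as_elim]
theorem induction_on {p : BalancedTensor R M N → Prop} (x : BalancedTensor R M N)
    (tmul : ∀ m n, p (tmul R m n)) (zero : p 0) (add : ∀ x y, p x → p y → p (x + y)) : p x := by
  obtain ⟨x, rfl⟩ := Submodule.Quotient.mk_surjective _ x
  induction x using TensorProduct.induction_on with
  | zero => exact zero
  | tmul m n => exact tmul m n
  | add x y hx hy => exact add _ _ hx hy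

theorem lTensor_tmul (f : N →ₗ[R] N') (m : M) (n : N) :
    lTensor R M f (tmul R m n) = tmul R m (f n) := rfl

/-- A balanced biadditive map induces an additive map on the tensor product. -/
noncomputable def lift {Q : Type*} [AddCommGroup Q] (f : M →+ N →+ Q)
    (hf : ∀ m (r : R) n, f (MulOpposite.op r • m) n = f m (r • n)) :
    BalancedTensor R M N →ₗ[ℤ] Q :=
  (balancedRelations R M N).liftQ
    (TensorProduct.lift (LinearMap.mk₂ ℤ (fun m n => f m n) (by simp) (by simp) (by simp)
      (by simp))) (Submodule.span_le.2 (by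
        rintro _ ⟨m, r, n, rfl⟩
        exact (map_sub (TensorProduct.lift _) _ _).trans (sub_eq_zero.2 (hf m r n))))

theorem lift_tmul {Q : Type*} [AddCommGroup Q] (f : M →+ N →+ Q)
    (hf : ∀ m (r : R) n, f (MulOpposite.op r • m) n = f m (r • n)) (m : M) (n : N) :
    lift f hf (tmul R m n) = f m n := by
  rfl

variable {ι : Type u}

/-- The pairing of a free right module with a left module `N`, with values in a direct sum of
copies of `N`. -/
noncomputable def act (R N : Type u) [Ring R] [AddCommGroup N] [Module R N] (ι : Type u) :
    (ι →₀ Rᵐᵒᵖ) →+ N →+ (ι →₀ N) where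
  toFun v :=
    { toFun := fun n => v.mapRange (fun a => a.unop • n) (by simp)
      map_zero' := by ext; simp
      map_add' := fun _ _ => by ext; simp }
  map_zero' := by ext; simp
  map_add' _ _ := by ext; simp [add_smul]

theorem act_apply (v : ι →₀ Rᵐᵒᵖ) (n : N) (s : ι) : act R N ι v n s = (v s).unop • n := rfl

theorem act_single (s : ι) (a : Rᵐᵒᵖ) (n : N) :
    act R N ι (Finsupp.single s a) n = Finsupp.single s (a.unop • n) :=
  Finsupp.mapRange_single (hf := by simp)

theorem act_smul (v : ι →₀ Rᵐᵒᵖ) (r : R) (n : N) :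
    act R N ι (MulOpposite.op r • v) n = act R N ι v (r • n) := by
  ext s
  simp [act_apply, mul_smul]

/-- The map `⨁ N → M ⊗ N` induced by a family of elements of `M`. -/
noncomputable def ofFinsupp (π : (ι →₀ Rᵐᵒᵖ) →ₗ[Rᵐᵒᵖ] M) : (ι →₀ N) →+ BalancedTensor R M N :=
  Finsupp.liftAddHom fun s => tmul R (π (Finsupp.single s 1))

theorem ofFinsupp_single (π : (ι →₀ Rᵐᵒᵖ) →ₗ[Rᵐᵒᵖ] M) (s : ι) (n : N) :
    ofFinsupp π (Finsupp.single s n) = tmul R (π (Finsupp.single s 1)) n := by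
  simp [ofFinsupp]

theorem ofFinsupp_act (π : (ι →₀ Rᵐᵒᵖ) →ₗ[Rᵐᵒᵖ] M) (v : ι →₀ Rᵐᵒᵖ) (n : N) :
    ofFinsupp π (act R N ι v n) = tmul R (π v) n := by
  induction v using Finsupp.induction_linear with
  | zero => simp
  | add v w hv hw => simp [hv, hw]
  | single s a =>
    rw [act_single, ofFinsupp_single, tmul_smul, ← map_smul]
    simp

theorem ofFinsupp_surjective (π : (ι →₀ Rᵐᵒᵖ) →ₗ[Rᵐᵒᵖ] M) (hπ : Function.Surjective π) :
    Function.Surjective (ofFinsupp (N := N) π) := by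
  intro x
  induction x using induction_on with
  | zero => exact ⟨0, map_zero _⟩
  | add x y hx hy =>
    obtain ⟨a, rfl⟩ := hx
    obtain ⟨b, rfl⟩ := hy
    exact ⟨a + b, map_add _ _ _⟩
  | tmul m n =>
    obtain ⟨v, rfl⟩ := hπ m
    exact ⟨act R N ι v n, ofFinsupp_act π v n⟩

theorem lTensor_ofFinsupp (π : (ι →₀ Rᵐᵒᵖ) →ₗ[Rᵐᵒᵖ] M) (f : N →ₗ[R] N') (z : ι →₀ N) :
    lTensor R M f (ofFinsupp π z) = ofFinsupp π (z.mapRange f (map_zero f)) := by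
  induction z using Finsupp.induction_linear with
  | zero => simp
  | add v w hv hw => rw [map_add, map_add, hv, hw, Finsupp.mapRange_add (by simp), map_add]
  | single s n => rw [ofFinsupp_single, Finsupp.mapRange_single, ofFinsupp_single, lTensor_tmul]

/-- The relations in `⨁ N` defining `M ⊗ N` for a presentation `π` of `M`. -/
noncomputable def relations (π : (ι →₀ Rᵐᵒᵖ) →ₗ[Rᵐᵒᵖ] M) (N : Type u) [AddCommGroup N] [Module R N] :
    AddSubgroup (ι →₀ N) :=
  AddSubgroup.closure {x | ∃ v ∈ LinearMap.ker π, ∃ n : N, x = act R N ι v n}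

/-- A set-theoretic section `σ` of `π` becomes biadditive and balanced modulo the relations. It
therefore induces a map `Φ` from the tensor product whose composite with `ofFinsupp π` is the
quotient map. -/
theorem mem_relations_of_ofFinsupp_eq_zero (π : (ι →₀ Rᵐᵒᵖ) →ₗ[Rᵐᵒᵖ] M)
    (hπ : Function.Surjective π) {z : ι →₀ N} (hz : ofFinsupp π z = 0) :
    z ∈ relations π N := by
  let Q := (ι →₀ N) ⧸ relations π N
  let q : (ι →₀ N) →+ Q := QuotientAddGroup.mk' _
  have hq (v w : ι →₀ Rᵐᵒᵖ) (h : π v = π w) (n : N) : q (act R N ι v n) = q (act R N ι w n) := by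
    rw [← sub_eq_zero, ← map_sub, ← AddMonoidHom.sub_apply, ← map_sub]
    refine (QuotientAddGroup.eq_zero_iff _).2 (AddSubgroup.subset_closure ⟨v - w, ?_, n, rfl⟩)
    rw [LinearMap.mem_ker, map_sub, h, sub_self]
  let σ := Function.surjInv hπ
  have hσ (m) : π (σ m) = m := Function.surjInv_eq hπ m
  let φ : M →+ N →+ Q := AddMonoidHom.mk' (fun m => q.comp (act R N ι (σ m))) fun a b => by
    ext n
    change q _ = q _ + q _
    rw [← map_add, ← AddMonoidHom.add_apply, ← map_add]
    exact hq _ _ (by simp [hσ]) n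
  let Φ : BalancedTensor R M N →ₗ[ℤ] Q := lift φ fun m r n => by
    change q _ = q _
    rw [← act_smul]
    exact hq _ _ (by simp [hσ]) n
  have hΦ (y : ι →₀ N) : Φ (ofFinsupp π y) = q y := by
    induction y using Finsupp.induction_linear with
    | zero => simp
    | add v w hv hw => rw [map_add, map_add, hv, hw, map_add]
    | single s n =>
      rw [ofFinsupp_single, lift_tmul]
      change q _ = q _
      rw [hq _ (Finsupp.single s 1) (hσ _), act_single]
      simp
  rw [← QuotientAddGroup.eq_zero_iff]
  exact (hΦ z).symm.trans (by rw [hz, map_zero])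

end BalancedTensor

open BalancedTensor

variable {M : Type u} [AddCommGroup M] [Module Rᵐᵒᵖ M] {ι : Type u}

/-- Let `I` be the left ideal generated by the coordinates of `k`. The element of `M ⊗ I` given by
these coordinates maps to `π k ⊗ 1 = 0` in `M ⊗ R`, so by flatness it already vanishes in `M ⊗ I`.
Its expression through relations with coefficients in `I` yields `χ` with `π ∘ₗ χ = 0` and `χ k =
k`; then `θ = 1 - χ`. -/
theorem IsFlatRightModule.exists_lift (hM : IsFlatRightModule R M)
    (π : (ι →₀ Rᵐᵒᵖ) →ₗ[Rᵐᵒᵖ] M) (hπ : Function.Surjective π) (k : ι →₀ Rᵐᵒᵖ) (hk : π k = 0) :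
    ∃ θ : (ι →₀ Rᵐᵒᵖ) →ₗ[Rᵐᵒᵖ] (ι →₀ Rᵐᵒᵖ), π ∘ₗ θ = π ∧ θ k = 0 := by
  let I : Submodule R R := Submodule.span R (Set.range fun s => (k s).unop)
  let z : ι →₀ I := Finsupp.onFinset k.support
    (fun s => ⟨(k s).unop, Submodule.subset_span ⟨s, rfl⟩⟩) (by
      intro s hs
      rw [Finsupp.mem_support_iff]
      intro h
      exact hs (Subtype.ext (by simp [h])))
  have hz : z.mapRange I.subtype (map_zero _) = act R R ι k 1 := by
    ext s
    simp [z, act_apply]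
  have hz0 : ofFinsupp π z = 0 := by
    apply hM I R I.subtype I.injective_subtype
    rw [lTensor_ofFinsupp, hz, ofFinsupp_act, hk]
    simp
  have hmem := mem_relations_of_ofFinsupp_eq_zero π hπ hz0
  have key (y : ι →₀ I) (hy : y ∈ relations π I) :
      ∃ χ : (ι →₀ Rᵐᵒᵖ) →ₗ[Rᵐᵒᵖ] (ι →₀ Rᵐᵒᵖ), π ∘ₗ χ = 0 ∧
        ∀ s, (χ k s).unop = (y s : R) := by
    induction hy using AddSubgroup.closure_induction with
    | zero => exact ⟨0, by simp, by simp⟩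
    | add a b _ _ ha hb =>
      obtain ⟨χ, h, h'⟩ := ha
      obtain ⟨χ', g, g'⟩ := hb
      exact ⟨χ + χ', by rw [LinearMap.comp_add, h, g, add_zero], fun s => by simp [h', g']⟩
    | neg a _ ha =>
      obtain ⟨χ, h, h'⟩ := ha
      exact ⟨-χ, by rw [LinearMap.comp_neg, h, neg_zero], fun s => by simp [h']⟩
    | mem x hx =>
      obtain ⟨v, hv, n, rfl⟩ := hx
      -- With `n = ∑ c s * k s`, sending the basis vector at `s` to `v` times `c s` sends `k` to `v`
      -- times `n`.
      obtain ⟨c, hc⟩ := (Finsupp.mem_span_range_iff_exists_finsupp).1 n.2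
      refine ⟨Finsupp.linearCombination Rᵐᵒᵖ fun s => MulOpposite.op (c s) • v, ?_, fun s => ?_⟩
      · refine Finsupp.lhom_ext' fun s => LinearMap.ext_ring ?_
        simp [LinearMap.mem_ker.1 hv]
      · classical
        have : Finsupp.linearCombination Rᵐᵒᵖ (fun s => MulOpposite.op (c s) • v) k =
            MulOpposite.op (n : R) • v := by
          rw [← hc, Finsupp.linearCombination_apply, Finsupp.sum_of_support_subset k
            (Finset.subset_union_left (s₂ := c.support)) _ (by simp),
            Finsupp.sum_of_support_subset c
            (Finset.subset_union_right (s₁ := k.support)) _ (by simp),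
            Finset.op_sum, Finset.sum_smul]
          exact Finset.sum_congr rfl fun s _ => by
            rw [smul_smul, smul_eq_mul, MulOpposite.op_mul, MulOpposite.op_unop]
        rw [this]
        simp [act_apply]
  obtain ⟨χ, h, h'⟩ := key z hmem
  refine ⟨LinearMap.id - χ, by rw [LinearMap.comp_sub, h, sub_zero, LinearMap.comp_id], ?_⟩
  rw [LinearMap.sub_apply, LinearMap.id_apply, sub_eq_zero]
  ext s
  exact MulOpposite.unop_injective (h' s).symm

theorem exists_lift_finset (π : (ι →₀ Rᵐᵒᵖ) →ₗ[Rᵐᵒᵖ] M)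
    (h : ∀ k : ι →₀ Rᵐᵒᵖ, π k = 0 →
      ∃ θ : (ι →₀ Rᵐᵒᵖ) →ₗ[Rᵐᵒᵖ] (ι →₀ Rᵐᵒᵖ), π ∘ₗ θ = π ∧ θ k = 0)
    (Y : Finset (ι →₀ Rᵐᵒᵖ)) (hY : ∀ k ∈ Y, π k = 0) :
    ∃ θ : (ι →₀ Rᵐᵒᵖ) →ₗ[Rᵐᵒᵖ] (ι →₀ Rᵐᵒᵖ), π ∘ₗ θ = π ∧ ∀ k ∈ Y, θ k = 0 := by
  classical
  induction Y using Finset.induction_on with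
  | empty => exact ⟨LinearMap.id, rfl, by simp⟩
  | insert k Y _ ih =>
    obtain ⟨θ, hθ, hθY⟩ := ih fun y hy => hY y (Finset.mem_insert_of_mem hy)
    obtain ⟨θ', hθ', hk⟩ := h (θ k)
      ((LinearMap.congr_fun hθ k).trans (hY k (Finset.mem_insert_self k Y)))
    refine ⟨θ' ∘ₗ θ, by rw [← LinearMap.comp_assoc, hθ', hθ], fun y hy => ?_⟩
    rcases Finset.mem_insert.1 hy with rfl | hy
    · exact hk
    · rw [LinearMap.comp_apply, hθY y hy, map_zero]

namespace BalancedTensor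

variable {N N' : Type u} [AddCommGroup N] [Module R N] [AddCommGroup N'] [Module R N']

/-- The action of an endomorphism of a free module on `⨁ N`. -/
noncomputable def mapFinsupp (θ : (ι →₀ Rᵐᵒᵖ) →ₗ[Rᵐᵒᵖ] (ι →₀ Rᵐᵒᵖ)) (N : Type u) [AddCommGroup N]
    [Module R N] : (ι →₀ N) →+ (ι →₀ N) :=
  Finsupp.liftAddHom fun s => act R N ι (θ (Finsupp.single s 1))

theorem mapFinsupp_single (θ : (ι →₀ Rᵐᵒᵖ) →ₗ[Rᵐᵒᵖ] (ι →₀ Rᵐᵒᵖ)) (s : ι) (n : N) :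
    mapFinsupp θ N (Finsupp.single s n) = act R N ι (θ (Finsupp.single s 1)) n := by
  simp [mapFinsupp]

theorem mapFinsupp_act (θ : (ι →₀ Rᵐᵒᵖ) →ₗ[Rᵐᵒᵖ] (ι →₀ Rᵐᵒᵖ)) (v : ι →₀ Rᵐᵒᵖ) (n : N) :
    mapFinsupp θ N (act R N ι v n) = act R N ι (θ v) n := by
  induction v using Finsupp.induction_linear with
  | zero => simp
  | add v w hv hw => simp [hv, hw]
  | single s a =>
    rw [act_single, mapFinsupp_single, ← act_smul, ← map_smul]
    simp

theorem mapFinsupp_mapRange (θ : (ι →₀ Rᵐᵒᵖ) →ₗ[Rᵐᵒᵖ] (ι →₀ Rᵐᵒᵖ)) (f : N →ₗ[R] N')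
    (z : ι →₀ N) :
    mapFinsupp θ N' (z.mapRange f (map_zero f)) =
      (mapFinsupp θ N z).mapRange f (map_zero f) := by
  induction z using Finsupp.induction_linear with
  | zero => simp
  | add v w hv hw =>
    rw [Finsupp.mapRange_add (by simp), map_add, hv, hw, map_add, Finsupp.mapRange_add (by simp)]
  | single s n =>
    rw [Finsupp.mapRange_single, mapFinsupp_single, mapFinsupp_single]
    ext t
    simp [act_apply]

theorem ofFinsupp_mapFinsupp (π : (ι →₀ Rᵐᵒᵖ) →ₗ[Rᵐᵒᵖ] M)
    (θ : (ι →₀ Rᵐᵒᵖ) →ₗ[Rᵐᵒᵖ] (ι →₀ Rᵐᵒᵖ)) (z : ι →₀ N) :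
    ofFinsupp π (mapFinsupp θ N z) = ofFinsupp (π ∘ₗ θ) z := by
  induction z using Finsupp.induction_linear with
  | zero => simp
  | add v w hv hw => rw [map_add, map_add, hv, hw, map_add]
  | single s n => rw [mapFinsupp_single, ofFinsupp_act, ofFinsupp_single, LinearMap.comp_apply]

end BalancedTensor

/-- If `z` represents an element killed by `f`, its image under `f` is a combination of relations
coming from finitely many vectors of `ker π`. A `θ` killing these vectors kills that image, hence
kills `z` by injectivity of `f`; since `π ∘ₗ θ = π`, the class of `z` is zero. -/
theorem isFlatRightModule_of_exists_lift
    (π : (ι →₀ Rᵐᵒᵖ) →ₗ[Rᵐᵒᵖ] M) (hπ : Function.Surjective π)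
    (h : ∀ k : ι →₀ Rᵐᵒᵖ, π k = 0 →
      ∃ θ : (ι →₀ Rᵐᵒᵖ) →ₗ[Rᵐᵒᵖ] (ι →₀ Rᵐᵒᵖ), π ∘ₗ θ = π ∧ θ k = 0) :
    IsFlatRightModule R M := by
  classical
  intro N N' _ _ _ _ f hf
  rw [injective_iff_map_eq_zero]
  intro x hx
  obtain ⟨z, rfl⟩ := ofFinsupp_surjective π hπ x
  rw [lTensor_ofFinsupp] at hx
  have key (y : ι →₀ N') (hy : y ∈ relations π N') :
      ∃ Y : Finset (ι →₀ Rᵐᵒᵖ), (∀ k ∈ Y, π k = 0) ∧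
        ∀ θ : (ι →₀ Rᵐᵒᵖ) →ₗ[Rᵐᵒᵖ] (ι →₀ Rᵐᵒᵖ), (∀ k ∈ Y, θ k = 0) →
          mapFinsupp θ N' y = 0 := by
    induction hy using AddSubgroup.closure_induction with
    | zero => exact ⟨∅, by simp, by simp⟩
    | add a b _ _ ha hb =>
      obtain ⟨Y, hY, h'⟩ := ha
      obtain ⟨Y', hY', h''⟩ := hb
      refine ⟨Y ∪ Y', fun k hk => (Finset.mem_union.1 hk).elim (hY k) (hY' k), fun θ hθ => ?_⟩
      rw [map_add, h' θ fun k hk => hθ k (Finset.mem_union_left _ hk),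
        h'' θ fun k hk => hθ k (Finset.mem_union_right _ hk), add_zero]
    | neg a _ ha =>
      obtain ⟨Y, hY, h'⟩ := ha
      exact ⟨Y, hY, fun θ hθ => by rw [map_neg, h' θ hθ, neg_zero]⟩
    | mem x hx =>
      obtain ⟨v, hv, n, rfl⟩ := hx
      refine ⟨{v}, by simpa using hv, fun θ hθ => ?_⟩
      rw [mapFinsupp_act, hθ v (by simp), map_zero, AddMonoidHom.zero_apply]
  obtain ⟨Y, hY, hYθ⟩ := key _ (mem_relations_of_ofFinsupp_eq_zero π hπ hx)
  obtain ⟨θ, hθ, hθY⟩ := exists_lift_finset π h Y hY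
  have h0 := hYθ θ hθY
  rw [mapFinsupp_mapRange] at h0
  have h1 : mapFinsupp θ N z = 0 :=
    Finsupp.mapRange_injective f (map_zero f) hf (h0.trans Finsupp.mapRange_zero.symm)
  rw [← hθ, ← ofFinsupp_mapFinsupp, h1, map_zero]

end Flat

/-! ### Countable approximations and closing off -/

section Approximation

variable {A : Type u} [Ring A] {F : ℕ → Type u} [∀ n, AddCommGroup (F n)] [∀ n, Module A (F n)]

/-- Families of sets of generators and modules of relations in the modules `F n`. -/
abbrev SubPresentation (A : Type u) [Ring A] (F : ℕ → Type u) [∀ n, AddCommGroup (F n)]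
    [∀ n, Module A (F n)] : Type u :=
  ∀ n, Set (F n) × Submodule A (F n →₀ A)

namespace SubPresentation

/-- A subpresentation is small if it has countably many generators and countably many relations,
the relations involve only the given generators, and they hold in the modules `F n`. -/
def IsSmall (j : SubPresentation A F) : Prop :=
  ∀ n, (j n).1.Countable ∧ (j n).2.CountablyGenerated ∧
    (j n).2 ≤ Finsupp.supported A A (j n).1 ∧
    (j n).2 ≤ LinearMap.ker (Finsupp.linearCombination A (id : F n → F n))

theorem fst_mono {j j' : SubPresentation A F} (h : j ≤ j') (n : ℕ) : (j n).1 ⊆ (j' n).1 :=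
  (h n).1

theorem snd_mono {j j' : SubPresentation A F} (h : j ≤ j') (n : ℕ) : (j n).2 ≤ (j' n).2 :=
  (h n).2

theorem supported_mono {j j' : SubPresentation A F} (h : j ≤ j') (n : ℕ) :
    Finsupp.supported A A (j n).1 ≤ Finsupp.supported A A (j' n).1 :=
  Finsupp.supported_mono (fst_mono h n)

theorem fst_iSup {κ : Type*} (j : κ → SubPresentation A F) (n : ℕ) :
    ((⨆ i, j i) n).1 = ⋃ i, (j i n).1 := by
  rw [iSup_apply, Prod.fst_iSup, Set.iSup_eq_iUnion]

theorem snd_iSup {κ : Type*} (j : κ → SubPresentation A F) (n : ℕ) :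
    ((⨆ i, j i) n).2 = ⨆ i, (j i n).2 := by
  rw [iSup_apply, Prod.snd_iSup]

theorem IsSmall.iSup {κ : Type*} [Countable κ] {j : κ → SubPresentation A F}
    (hj : ∀ i, IsSmall (j i)) : IsSmall (⨆ i, j i) := by
  intro n
  rw [fst_iSup, snd_iSup]
  exact ⟨Set.countable_iUnion fun i => (hj i n).1, .iSup fun i => (hj i n).2.1,
    iSup_le fun i => (hj i n).2.2.1.trans
      (Finsupp.supported_mono (Set.subset_iUnion (fun i => (j i n).1) i)),
    iSup_le fun i => (hj i n).2.2.2⟩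

theorem IsSmall.sup {j j' : SubPresentation A F} (hj : IsSmall j) (hj' : IsSmall j') :
    IsSmall (j ⊔ j') := by
  rw [sup_eq_iSup]
  exact IsSmall.iSup (by simp [hj, hj'])

theorem exists_isSmall_forall {κ : Type*} [Countable κ] (Q : κ → SubPresentation A F → Prop)
    (mono : ∀ i j j', j ≤ j' → Q i j → Q i j') (h : ∀ i, ∃ j, IsSmall j ∧ Q i j) :
    ∃ j, IsSmall j ∧ ∀ i, Q i j := by
  choose j hj hQ using h
  exact ⟨⨆ i, j i, IsSmall.iSup hj, fun i => mono i _ _ (le_iSup j i) (hQ i)⟩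

theorem exists_isSmall_mem (n : ℕ) {S : Set (F n)} (hS : S.Countable) {W : Set (F n →₀ A)}
    (hW : W.Countable)
    (h : ∀ w ∈ W, Finsupp.linearCombination A (id : F n → F n) w = 0) :
    ∃ j : SubPresentation A F, IsSmall j ∧ S ⊆ (j n).1 ∧ W ⊆ (j n).2 := by
  refine ⟨Function.update ⊥ n (S ∪ ⋃ w ∈ W, (w.support : Set (F n)), Submodule.span A W),
    fun m => ?_, ?_, ?_⟩
  · rcases eq_or_ne m n with rfl | hm
    · rw [Function.update_self]
      refine ⟨hS.union (hW.biUnion fun w _ => w.support.countable_toSet), .of_set hW,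
        Submodule.span_le.2 fun w hw => (Finsupp.mem_supported A w).2 ?_,
        Submodule.span_le.2 h⟩
      exact (Set.subset_biUnion_of_mem (u := fun w : F m →₀ A => (w.support : Set (F m)))
        hw).trans Set.subset_union_right
    · rw [Function.update_of_ne hm]
      exact ⟨Set.countable_empty, .bot, bot_le, bot_le⟩
  · rw [Function.update_self]
    exact Set.subset_union_left
  · rw [Function.update_self]
    exact Submodule.subset_span

variable (d : ∀ n : ℕ, F n →ₗ[A] F (n + 1))

/-- The homomorphism of free covers induced by the differential. -/
noncomputable abbrev diff (n : ℕ) : (F n →₀ A) →ₗ[A] (F (n + 1) →₀ A) :=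
  Finsupp.lmapDomain A A (d n)

theorem linearCombination_diff (n : ℕ) (v : F n →₀ A) :
    Finsupp.linearCombination A (id : F (n + 1) → F (n + 1)) (diff d n v) =
      d n (Finsupp.linearCombination A (id : F n → F n) v) := by
  simp [diff, Finsupp.linearCombination_mapDomain, Finsupp.apply_linearCombination]

/-- The data in `j'` witness that `j` maps to a complex of flat modules which is exact in
positive degrees. -/
structure Absorbs (j j' : SubPresentation A F) : Prop where
  map_gen : ∀ n, ∀ x ∈ (j n).1, d n x ∈ (j' (n + 1)).1
  map_rel : ∀ n, (j n).2 ≤ (j' (n + 1)).2.comap (diff d n)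
  zero_rel : ∀ n, Finsupp.single 0 1 ∈ (j' n).2
  exact : ∀ n, Finsupp.supported A A (j (n + 1)).1 ⊓ (j (n + 2)).2.comap (diff d (n + 1)) ≤
    (Finsupp.supported A A (j' n).1).map (diff d n) ⊔ (j' (n + 1)).2
  lift : ∀ n, ∀ v ∈ (j n).2, ∀ E : Finset (F n), (E : Set (F n)) ⊆ (j n).1 →
    ∃ θ : (F n →₀ A) →ₗ[A] (F n →₀ A), θ v = 0 ∧
      ∀ s ∈ E, θ (Finsupp.single s 1) - Finsupp.single s 1 ∈ (j' n).2

variable {d}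

theorem Absorbs.mono {j j' j'' : SubPresentation A F} (h : Absorbs d j j') (hj : j' ≤ j'') :
    Absorbs d j j'' where
  map_gen n x hx := fst_mono hj _ (h.map_gen n x hx)
  map_rel n := (h.map_rel n).trans (Submodule.comap_mono (snd_mono hj _))
  zero_rel n := snd_mono hj _ (h.zero_rel n)
  exact n := (h.exact n).trans
    (sup_le_sup (Submodule.map_mono (supported_mono hj _)) (snd_mono hj _))
  lift n v hv E hE := by
    obtain ⟨θ, h0, h1⟩ := h.lift n v hv E hE
    exact ⟨θ, h0, fun s hs => snd_mono hj _ (h1 s hs)⟩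

theorem mem_snd_iSup {κ : Type*} [Nonempty κ] {j : κ → SubPresentation A F}
    (hj : Directed (· ≤ ·) j) {n : ℕ} {v : F n →₀ A} (hv : v ∈ ((⨆ i, j i) n).2) :
    ∃ i, v ∈ (j i n).2 := by
  rw [snd_iSup] at hv
  have hdir : Directed (· ≤ ·) fun i => (j i n).2 := fun a b =>
    let ⟨c, ha, hb⟩ := hj a b
    ⟨c, snd_mono ha n, snd_mono hb n⟩
  exact (Submodule.mem_iSup_of_directed _ hdir).1 hv

theorem mem_supported_iSup {κ : Type*} [Nonempty κ] {j : κ → SubPresentation A F}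
    (hj : Directed (· ≤ ·) j) {n : ℕ} {v : F n →₀ A}
    (hv : v ∈ Finsupp.supported A A ((⨆ i, j i) n).1) :
    ∃ i, v ∈ Finsupp.supported A A (j i n).1 := by
  rw [fst_iSup, Finsupp.supported_iUnion] at hv
  have hdir : Directed (· ≤ ·) fun i => Finsupp.supported A A (j i n).1 := fun a b =>
    let ⟨c, ha, hb⟩ := hj a b
    ⟨c, supported_mono ha n, supported_mono hb n⟩
  exact (Submodule.mem_iSup_of_directed _ hdir).1 hv

/-- Each condition concerns finitely many generators and relations, which all occur at one stage,
and the next stage supplies the witnesses. The finiteness of `E` in `Absorbs.lift` is needed here: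
no single `θ` need serve all generators of the union. -/
theorem Absorbs.iSup {j : ℕ → SubPresentation A F} (hmono : Monotone j)
    (h : ∀ i, Absorbs d (j i) (j (i + 1))) : Absorbs d (⨆ i, j i) (⨆ i, j i) := by
  have hdir : Directed (· ≤ ·) j := hmono.directed_le
  have h' (i) : Absorbs d (j i) (⨆ i, j i) := (h i).mono (le_iSup j _)
  refine ⟨fun n x hx => ?_, fun n v hv => ?_, (h' 0).zero_rel, fun n v hv => ?_,
    fun n v hv E hE => ?_⟩
  · rw [fst_iSup, Set.mem_iUnion] at hx
    obtain ⟨i, hi⟩ := hx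
    exact (h' i).map_gen n x hi
  · obtain ⟨i, hi⟩ := mem_snd_iSup hdir hv
    exact (h' i).map_rel n hi
  · obtain ⟨i, hi⟩ := mem_supported_iSup hdir hv.1
    obtain ⟨k, hk⟩ := mem_snd_iSup hdir hv.2
    exact (h' (max i k)).exact n ⟨supported_mono (hmono (le_max_left i k)) _ hi,
      snd_mono (hmono (le_max_right i k)) _ hk⟩
  · obtain ⟨i, hi⟩ := mem_snd_iSup hdir hv
    rw [fst_iSup] at hE
    have hdir' : Directed (· ⊆ ·) fun i => (j i n).1 := fun a b =>
      let ⟨c, ha, hb⟩ := hdir a b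
      ⟨c, fst_mono ha n, fst_mono hb n⟩
    obtain ⟨k, hk⟩ := hdir'.exists_mem_subset_of_finset_subset_biUnion hE
    exact (h' (max i k)).lift n v (snd_mono (hmono (le_max_left i k)) _ hi) E
      (hk.trans (fst_mono (hmono (le_max_right i k)) _))

theorem IsSmall.exists_absorbs {j : SubPresentation A F} (hj : IsSmall j)
    (hA : HasCountablyGeneratedKernels A A) (hd : ∀ n, Function.Exact (d n) (d (n + 1)))
    (hF : ∀ n (Y : Finset (F n →₀ A)),
      (∀ k ∈ Y, Finsupp.linearCombination A (id : F n → F n) k = 0) →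
      ∃ θ : (F n →₀ A) →ₗ[A] (F n →₀ A), Finsupp.linearCombination A (id : F n → F n) ∘ₗ θ =
        Finsupp.linearCombination A (id : F n → F n) ∧ ∀ k ∈ Y, θ k = 0) :
    ∃ j', IsSmall j' ∧ j ≤ j' ∧ Absorbs d j j' := by
  obtain ⟨j₁, hs₁, h₁⟩ := exists_isSmall_forall (A := A) (F := F)
    (fun n j' => ∀ x ∈ (j n).1, d n x ∈ (j' (n + 1)).1)
    (fun n j' j'' h hj' x hx => fst_mono h _ (hj' x hx)) fun n => by
      obtain ⟨j', h, h', -⟩ := exists_isSmall_mem (A := A) (n + 1) ((hj n).1.image (d n))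
        Set.countable_empty (by simp)
      exact ⟨j', h, fun x hx => h' ⟨x, hx, rfl⟩⟩
  obtain ⟨j₂, hs₂, h₂⟩ := exists_isSmall_forall (A := A) (F := F)
    (fun n j' => (j n).2 ≤ (j' (n + 1)).2.comap (diff d n))
    (fun n j' j'' h hj' => hj'.trans (Submodule.comap_mono (snd_mono h _))) fun n => by
      obtain ⟨-, ⟨G, hG, hGj⟩, -, hker⟩ := hj n
      obtain ⟨j', h, -, h'⟩ := exists_isSmall_mem (n + 1) Set.countable_empty
        (hG.image (diff d n)) (by
          rintro _ ⟨v, hv, rfl⟩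
          rw [linearCombination_diff, hker (hGj ▸ Submodule.subset_span hv), map_zero])
      refine ⟨j', h, ?_⟩
      rw [← hGj, Submodule.span_le]
      exact fun v hv => h' ⟨v, hv, rfl⟩
  obtain ⟨j₃, hs₃, h₃⟩ := exists_isSmall_forall (A := A) (F := F)
    (fun n j' => Finsupp.single 0 1 ∈ (j' n).2) (fun n j' j'' h hj' => snd_mono h _ hj')
    fun n => by
      obtain ⟨j', h, -, h'⟩ := exists_isSmall_mem (F := F) n Set.countable_empty
        (Set.countable_singleton (Finsupp.single 0 (1 : A))) (by simp)
      exact ⟨j', h, h' rfl⟩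
  obtain ⟨j₄, hs₄, h₄⟩ := exists_isSmall_forall (A := A) (F := F)
    (fun n j' => Finsupp.supported A A (j (n + 1)).1 ⊓ (j (n + 2)).2.comap (diff d (n + 1)) ≤
      (Finsupp.supported A A (j' n).1).map (diff d n) ⊔ (j' (n + 1)).2)
    (fun n j' j'' h hj' => hj'.trans
      (sup_le_sup (Submodule.map_mono (supported_mono h _)) (snd_mono h _))) fun n => by
      -- The cocycles in degree `n + 1` are countably generated by coherence, so it suffices to
      -- bound countably many of them.
      have hZ := ((hA.finsupp (F (n + 2))).quotient (hj (n + 2)).2.1).inf_ker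
        (Submodule.CountablyGenerated.supported (hj (n + 1)).1)
        ((j (n + 2)).2.mkQ ∘ₗ diff d (n + 1))
      rw [LinearMap.ker_comp, Submodule.ker_mkQ] at hZ
      obtain ⟨H, hH, hHZ⟩ := hZ
      have := hH.to_subtype
      obtain ⟨j', hs, h'⟩ := exists_isSmall_forall (A := A) (F := F)
        (fun (v : H) j' => v.1 ∈
          (Finsupp.supported A A (j' n).1).map (diff d n) ⊔ (j' (n + 1)).2)
        (fun v j' j'' h hj' =>
          sup_le_sup (Submodule.map_mono (supported_mono h _)) (snd_mono h _) hj') fun v => by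
          have hv : v.1 ∈ Submodule.span A H := Submodule.subset_span v.2
          rw [hHZ] at hv
          have hv0 := (hj (n + 2)).2.2.2 hv.2
          rw [LinearMap.mem_ker, linearCombination_diff] at hv0
          -- Exactness of the original complex provides `y`. Adjoining `y` as a generator and `v -
          -- [d y]` as a relation makes `v` a coboundary.
          obtain ⟨y, hy⟩ := (hd n _).1 hv0
          obtain ⟨k, hk, hky, -⟩ := exists_isSmall_mem (A := A) n (Set.countable_singleton y)
            Set.countable_empty (by simp)
          obtain ⟨l, hl, -, hly⟩ := exists_isSmall_mem (n + 1) Set.countable_empty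
            (Set.countable_singleton (v.1 - Finsupp.single (d n y) 1)) (by simp [hy])
          refine ⟨k ⊔ l, hk.sup hl, Submodule.mem_sup.2
            ⟨Finsupp.single (d n y) 1, ⟨Finsupp.single y 1, ?_, ?_⟩, _,
              snd_mono le_sup_right _ (hly rfl), add_sub_cancel _ _⟩⟩
          · exact Finsupp.single_mem_supported A 1 (fst_mono le_sup_left _ (hky rfl))
          · simp [diff]
      refine ⟨j', hs, ?_⟩
      rw [← hHZ, Submodule.span_le]
      exact fun v hv => h' ⟨v, hv⟩
  obtain ⟨j₅, hs₅, h₅⟩ := exists_isSmall_forall (A := A) (F := F)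
    (fun n j' => ∀ v ∈ (j n).2,
      ∃ θ : (F n →₀ A) →ₗ[A] (F n →₀ A), θ v = 0 ∧
        ∀ s ∈ (j n).1, θ (Finsupp.single s 1) - Finsupp.single s 1 ∈ (j' n).2)
    (fun n j' j'' h hj' v hv => by
      obtain ⟨θ, h0, h1⟩ := hj' v hv
      exact ⟨θ, h0, fun s hs => snd_mono h _ (h1 s hs)⟩) fun n => by
      classical
      obtain ⟨hS, ⟨G, hG, hGj⟩, -, hker⟩ := hj n
      have := hG.to_subtype
      -- There may be uncountably many relations `v`, but each lies in the span of a finite subset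
      -- of `G`. One `θ` for each of the countably many finite subsets suffices.
      obtain ⟨j', hs, h'⟩ := exists_isSmall_forall (A := A) (F := F)
        (fun (Y : Finset G) j' =>
          ∃ θ : (F n →₀ A) →ₗ[A] (F n →₀ A), (∀ v ∈ Y, θ v = 0) ∧
            ∀ s ∈ (j n).1, θ (Finsupp.single s 1) - Finsupp.single s 1 ∈ (j' n).2)
        (fun Y j' j'' h hj' => by
          obtain ⟨θ, h0, h1⟩ := hj'
          exact ⟨θ, h0, fun s hs => snd_mono h _ (h1 s hs)⟩) fun Y => by
          obtain ⟨θ, hθ, hY⟩ := hF n (Y.image Subtype.val) (by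
            intro k hk
            obtain ⟨w, -, rfl⟩ := Finset.mem_image.1 hk
            exact hker (hGj ▸ Submodule.subset_span w.2))
          obtain ⟨l, hl, -, hly⟩ := exists_isSmall_mem n Set.countable_empty
            (hS.image fun s => θ (Finsupp.single s 1) - Finsupp.single s 1) (by
              rintro _ ⟨s, -, rfl⟩
              rw [map_sub, ← LinearMap.comp_apply, hθ, sub_self])
          exact ⟨l, hl, θ, fun v hv => hY v (Finset.mem_image_of_mem _ hv),
            fun s hs => hly ⟨s, hs, rfl⟩⟩
      refine ⟨j', hs, fun v hv => ?_⟩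
      rw [← hGj] at hv
      obtain ⟨Y, hYG, hvY⟩ := Submodule.mem_span_finite_of_mem_span hv
      obtain ⟨θ, h0, h1⟩ := h' (Y.subtype (· ∈ G))
      refine ⟨θ, ?_, h1⟩
      have : Submodule.span A (Y : Set (F n →₀ A)) ≤ LinearMap.ker θ :=
        Submodule.span_le.2 fun w hw => h0 ⟨w, hYG hw⟩ (by simpa using hw)
      exact this hvY
  refine ⟨j ⊔ j₁ ⊔ j₂ ⊔ j₃ ⊔ j₄ ⊔ j₅, ((((hj.sup hs₁).sup hs₂).sup hs₃).sup hs₄).sup hs₅, ?_, ?_⟩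
  · exact le_sup_left.trans (le_sup_left.trans (le_sup_left.trans (le_sup_left.trans le_sup_left)))
  have l₄ : j₄ ≤ j ⊔ j₁ ⊔ j₂ ⊔ j₃ ⊔ j₄ ⊔ j₅ := le_sup_right.trans le_sup_left
  have l₃ : j₃ ≤ j ⊔ j₁ ⊔ j₂ ⊔ j₃ ⊔ j₄ ⊔ j₅ :=
    le_sup_right.trans (le_sup_left.trans le_sup_left)
  have l₂ : j₂ ≤ j ⊔ j₁ ⊔ j₂ ⊔ j₃ ⊔ j₄ ⊔ j₅ :=
    le_sup_right.trans (le_sup_left.trans (le_sup_left.trans le_sup_left))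
  have l₁ : j₁ ≤ j ⊔ j₁ ⊔ j₂ ⊔ j₃ ⊔ j₄ ⊔ j₅ :=
    le_sup_right.trans (le_sup_left.trans (le_sup_left.trans (le_sup_left.trans le_sup_left)))
  refine ⟨fun n x hx => fst_mono l₁ _ (h₁ n x hx), fun n v hv => snd_mono l₂ _ (h₂ n hv),
    fun n => snd_mono l₃ _ (h₃ n), fun n => (h₄ n).trans
      (sup_le_sup (Submodule.map_mono (supported_mono l₄ _)) (snd_mono l₄ _)),
    fun n v hv E hE => ?_⟩
  obtain ⟨θ, h0, h⟩ := h₅ n v hv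
  exact ⟨θ, h0, fun s hs => snd_mono le_sup_right _ (h s (hE hs))⟩

/-- Iterate the enlargement countably often and take the union, which absorbs itself by
`Absorbs.iSup`. -/
theorem IsSmall.exists_absorbs_self {j : SubPresentation A F} (hj : IsSmall j)
    (h : ∀ j : SubPresentation A F, IsSmall j → ∃ j', IsSmall j' ∧ j ≤ j' ∧ Absorbs d j j') :
    ∃ j', IsSmall j' ∧ j ≤ j' ∧ Absorbs d j' j' := by
  choose! g hg hle habs using h
  have hs (i : ℕ) : IsSmall (g^[i] j) := by
    induction i with
    | zero => exact hj
    | succ i ih => rw [Function.iterate_succ_apply']; exact hg _ ih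
  refine ⟨⨆ i, g^[i] j, IsSmall.iSup hs, le_iSup (fun i => g^[i] j) 0,
    Absorbs.iSup (monotone_nat_of_le_succ fun i => ?_) fun i => ?_⟩
  · rw [Function.iterate_succ_apply']
    exact hle _ (hs i)
  · rw [Function.iterate_succ_apply']
    exact habs _ (hs i)

end SubPresentation

end Approximation

/-! ### Subquotients and their exact sequences -/

section Subquotient

variable {A : Type*} [Ring A] {L L' L'' : Type*} [AddCommGroup L] [Module A L]
  [AddCommGroup L'] [Module A L'] [AddCommGroup L''] [Module A L'']

/-- The image of `U` in `L ⧸ T`, as a quotient of `U`. -/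
abbrev Subquotient (U T : Submodule A L) := U ⧸ T.submoduleOf U

namespace Subquotient

variable {U T : Submodule A L} {U' T' : Submodule A L'} {U'' T'' : Submodule A L''}

/-- The class of an element of `U`. -/
def mk (U T : Submodule A L) : U →ₗ[A] Subquotient U T := (T.submoduleOf U).mkQ

theorem mk_surjective (U T : Submodule A L) : Function.Surjective (mk U T) :=
  Submodule.mkQ_surjective _

theorem mk_eq_zero {v : U} : mk U T v = 0 ↔ (v : L) ∈ T :=
  Submodule.Quotient.mk_eq_zero _

theorem mk_eq_mk {v w : U} : mk U T v = mk U T w ↔ (v - w : L) ∈ T := by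
  rw [← sub_eq_zero, ← map_sub, mk_eq_zero, Submodule.coe_sub]

/-- The homomorphism of subquotients induced by a homomorphism of the ambient modules. -/
def map (f : L →ₗ[A] L') (hU : U ≤ U'.comap f) (hT : T ≤ T'.comap f) :
    Subquotient U T →ₗ[A] Subquotient U' T' :=
  Submodule.mapQ _ _ (f.restrict hU) fun _ hv => hT hv

theorem map_mk (f : L →ₗ[A] L') (hU : U ≤ U'.comap f) (hT : T ≤ T'.comap f) (v : U) :
    map f hU hT (mk U T v) = mk U' T' ⟨f v, hU v.2⟩ := rfl

/-- The homomorphism out of a subquotient induced by a homomorphism of the ambient module. -/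
def desc (f : L →ₗ[A] L') (hT : T ≤ LinearMap.ker f) : Subquotient U T →ₗ[A] L' :=
  (T.submoduleOf U).liftQ (f ∘ₗ U.subtype) fun _ hv => hT hv

theorem desc_mk (f : L →ₗ[A] L') (hT : T ≤ LinearMap.ker f) (v : U) :
    desc f hT (mk U T v) = f v := rfl

theorem exact_map (f : L →ₗ[A] L') (hU : U ≤ U'.comap f) (hT : T ≤ T'.comap f)
    (g : L' →ₗ[A] L'') (hU' : U' ≤ U''.comap g) (hT' : T' ≤ T''.comap g)
    (h : U ≤ T''.comap (g ∘ₗ f)) (h' : U' ⊓ T''.comap g ≤ U.map f ⊔ T') :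
    Function.Exact (map f hU hT) (map g hU' hT') := by
  intro x
  obtain ⟨v, rfl⟩ := mk_surjective U' T' x
  constructor
  · rw [map_mk, mk_eq_zero]
    intro hv
    obtain ⟨_, ⟨w, hw, rfl⟩, t, ht, hwt⟩ := Submodule.mem_sup.1 (h' ⟨v.2, hv⟩)
    refine ⟨mk U T ⟨w, hw⟩, ?_⟩
    rw [map_mk, mk_eq_mk, ← hwt, sub_add_cancel_left]
    exact neg_mem ht
  · rintro ⟨y, hy⟩
    obtain ⟨w, rfl⟩ := mk_surjective U T y
    have : map g hU' hT' (map f hU hT (mk U T w)) = 0 := by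
      rw [map_mk, map_mk, mk_eq_zero]
      exact h w.2
    rwa [hy] at this

theorem map_injective (f : L →ₗ[A] L') (hU : U ≤ U'.comap f) (hT : T ≤ T'.comap f)
    (h : U ⊓ T'.comap f ≤ T) : Function.Injective (map f hU hT) := by
  rw [injective_iff_map_eq_zero]
  intro x hx
  obtain ⟨v, rfl⟩ := mk_surjective U T x
  rw [map_mk, mk_eq_zero] at hx
  exact mk_eq_zero.2 (h ⟨v.2, hx⟩)

end Subquotient

/-- The subquotient embeds in `L ⧸ T`, and countable generation of kernels passes to `L ⧸ T` and
then to its submodules. -/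
theorem Subquotient.isCountablyPresentable {A L : Type u} [Ring A] [AddCommGroup L] [Module A L]
    (hL : HasCountablyGeneratedKernels A L) {U T : Submodule A L} (hU : U.CountablyGenerated)
    (hT : T.CountablyGenerated) : IsCountablyPresentable A (Subquotient U T) := by
  refine HasCountablyGeneratedKernels.isCountablyPresentable ?_ ?_
  · refine (hL.quotient hT).of_injective (desc (U := U) T.mkQ (Submodule.ker_mkQ T).ge) ?_
    rw [injective_iff_map_eq_zero]
    intro x hx
    obtain ⟨v, rfl⟩ := mk_surjective U T x
    exact mk_eq_zero.2 ((Submodule.Quotient.mk_eq_zero T).1 hx)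
  · obtain ⟨g, rfl⟩ := hU.exists_range_eq
    have := Submodule.CountablyGenerated.range (mk _ T ∘ₗ g.rangeRestrict)
    rwa [LinearMap.range_comp, LinearMap.range_rangeRestrict, ← LinearMap.range_eq_map,
      LinearMap.range_eq_top.2 (mk_surjective _ T)] at this

end Subquotient

/-! ### Closed approximations: flatness and cocycles -/

namespace SubPresentation

variable {R : Type u} [Ring R] {F : ℕ → Type u} [∀ n, AddCommGroup (F n)]
  [∀ n, Module Rᵐᵒᵖ (F n)] {d : ∀ n : ℕ, F n →ₗ[Rᵐᵒᵖ] F (n + 1)}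

theorem Absorbs.isFlatRightModule {j : SubPresentation Rᵐᵒᵖ F} (hj : IsSmall j)
    (h : Absorbs d j j) (n : ℕ) :
    IsFlatRightModule R (Subquotient (Finsupp.supported Rᵐᵒᵖ Rᵐᵒᵖ (j n).1) (j n).2) := by
  classical
  let i : ((j n).1 →₀ Rᵐᵒᵖ) →ₗ[Rᵐᵒᵖ] Finsupp.supported Rᵐᵒᵖ Rᵐᵒᵖ (j n).1 :=
    (Finsupp.supportedEquivFinsupp (M := Rᵐᵒᵖ) (R := Rᵐᵒᵖ) (j n).1).symm
  let p : (F n →₀ Rᵐᵒᵖ) →ₗ[Rᵐᵒᵖ] ((j n).1 →₀ Rᵐᵒᵖ) := Finsupp.lsubtypeDomain (j n).1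
  have hip (v : F n →₀ Rᵐᵒᵖ) (hv : v ∈ Finsupp.supported Rᵐᵒᵖ Rᵐᵒᵖ (j n).1) :
      i (p v) = ⟨v, hv⟩ :=
    (Finsupp.supportedEquivFinsupp (j n).1).symm_apply_apply ⟨v, hv⟩
  have hi (s : (j n).1) : (i (Finsupp.single s 1) : F n →₀ Rᵐᵒᵖ) = Finsupp.single s.1 1 :=
    Finsupp.supportedEquivFinsupp_symm_single (j n).1 s 1
  refine isFlatRightModule_of_exists_lift (Subquotient.mk _ _ ∘ₗ i)
    ((Subquotient.mk_surjective _ _).comp (LinearEquiv.surjective _)) fun k hk => ?_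
  replace hk := Subquotient.mk_eq_zero.1 hk
  obtain ⟨θ, h0, h1⟩ := h.lift n _ hk _ ((Finsupp.mem_supported _ _).1 (i k).2)
  set E := (i k : F n →₀ Rᵐᵒᵖ).support
  -- `θ` is controlled only on the support `E` of the relation. Replacing it by the identity on the
  -- other basis vectors gives a map congruent to the identity modulo the relations, hence one
  -- preserving the span of the chosen generators, and with the same value on `i k`.
  let θ' : (F n →₀ Rᵐᵒᵖ) →ₗ[Rᵐᵒᵖ] (F n →₀ Rᵐᵒᵖ) := Finsupp.linearCombination Rᵐᵒᵖ
    fun s => if s ∈ E then θ (Finsupp.single s 1) else Finsupp.single s 1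
  have hθ' (s : F n) : θ' (Finsupp.single s 1) - Finsupp.single s 1 ∈ (j n).2 := by
    simp only [θ', Finsupp.linearCombination_single, one_smul]
    split_ifs with hs
    · exact h1 s hs
    · simp
  refine ⟨p ∘ₗ θ' ∘ₗ Submodule.subtype _ ∘ₗ i, Finsupp.lhom_ext' fun s => LinearMap.ext_ring ?_, ?_⟩
  · simp only [LinearMap.comp_apply, Finsupp.lsingle_apply, Submodule.subtype_apply, hi]
    have hs : θ' (Finsupp.single s.1 1) ∈ Finsupp.supported Rᵐᵒᵖ Rᵐᵒᵖ (j n).1 := by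
      have := add_mem ((hj n).2.2.1 (hθ' s)) (Finsupp.single_mem_supported Rᵐᵒᵖ 1 s.2)
      rwa [sub_add_cancel] at this
    rw [hip _ hs, Subquotient.mk_eq_mk, hi]
    exact hθ' s
  · have : θ' (i k) = 0 := by
      rw [← h0, Finsupp.linearCombination_apply]
      conv_rhs => rw [← Finsupp.sum_single (i k : F n →₀ Rᵐᵒᵖ), map_finsuppSum]
      refine Finset.sum_congr rfl fun s hs => ?_
      change _ • (if s ∈ E then _ else _) = _
      rw [if_pos hs, ← map_smul]
      simp
    simp only [LinearMap.comp_apply, Submodule.subtype_apply, this, map_zero]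

variable (d) in
/-- The degree zero cocycles, as elements of the free cover. -/
noncomputable def cocycles (j : SubPresentation Rᵐᵒᵖ F) : Submodule Rᵐᵒᵖ (F 0 →₀ Rᵐᵒᵖ) :=
  Finsupp.supported Rᵐᵒᵖ Rᵐᵒᵖ (j 0).1 ⊓ (j 1).2.comap (diff d 0)

theorem cocycles_mono {j j' : SubPresentation Rᵐᵒᵖ F} (h : j ≤ j') :
    cocycles d j ≤ cocycles d j' :=
  inf_le_inf (supported_mono h 0) (Submodule.comap_mono (snd_mono h 1))

theorem IsSmall.isCountablyPresentable_cocycles {j : SubPresentation Rᵐᵒᵖ F} (hj : IsSmall j)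
    (hR : HasCountablyGeneratedKernels Rᵐᵒᵖ Rᵐᵒᵖ) :
    IsCountablyPresentable Rᵐᵒᵖ (Subquotient (cocycles d j) (j 0).2) := by
  refine Subquotient.isCountablyPresentable (hR.finsupp _) ?_ (hj 0).2.1
  have := ((hR.finsupp _).quotient (hj 1).2.1).inf_ker
    (Submodule.CountablyGenerated.supported (hj 0).1) ((j 1).2.mkQ ∘ₗ diff d 0)
  rwa [LinearMap.ker_comp, Submodule.ker_mkQ] at this

theorem Absorbs.isFlatlyCoresolved {j : SubPresentation Rᵐᵒᵖ F} (hj : IsSmall j)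
    (h : Absorbs d j j) (hd : ∀ n x, d (n + 1) (d n x) = 0) :
    IsFlatlyCoresolved R (ModuleCat.of Rᵐᵒᵖ (Subquotient (cocycles d j) (j 0).2)) := by
  have hU (n) : Finsupp.supported Rᵐᵒᵖ Rᵐᵒᵖ (j n).1 ≤
      (Finsupp.supported Rᵐᵒᵖ Rᵐᵒᵖ (j (n + 1)).1).comap (diff d n) := by
    rw [Finsupp.supported_eq_span_single, Submodule.span_le]
    rintro _ ⟨x, hx, rfl⟩
    simpa [diff] using Finsupp.single_mem_supported Rᵐᵒᵖ (1 : Rᵐᵒᵖ) (h.map_gen n x hx)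
  refine ⟨fun n => ModuleCat.of Rᵐᵒᵖ (Subquotient (Finsupp.supported Rᵐᵒᵖ Rᵐᵒᵖ (j n).1) (j n).2),
    Subquotient.map LinearMap.id inf_le_left le_rfl,
    fun n => Subquotient.map (diff d n) (hU n) (h.map_rel n), h.isFlatRightModule hj,
    Subquotient.map_injective _ _ _ inf_le_right,
    Subquotient.exact_map _ _ _ _ _ _ inf_le_right ?_,
    fun n => Subquotient.exact_map _ _ _ _ _ _ ?_ (h.exact n)⟩
  · rw [Submodule.map_id]
    exact le_sup_left
  · rw [Finsupp.supported_eq_span_single, Submodule.span_le]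
    rintro _ ⟨x, -, rfl⟩
    -- On free covers the composite differential sends each basis vector to the one at `0`, which is
    -- nonzero if `R` is nontrivial; it vanishes in the quotient because `zero_rel` makes it a
    -- relation.
    simpa [diff, hd] using h.zero_rel (n + 2)

end SubPresentation

/-! ### The colimit presentation -/

/-- Recognition of filtered colimits of modules. -/
noncomputable def ModuleCat.isColimitOfFiltered {A : Type u} [Ring A] {J : Type u} [PartialOrder J]
    [IsFiltered J] {K : J ⥤ ModuleCat.{u} A} (c : Cocone K)
    (hsurj : ∀ x : c.pt, ∃ (j : J) (y : K.obj j), c.ι.app j y = x)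
    (hinj : ∀ (j : J) (y : K.obj j), c.ι.app j y = 0 → ∃ (k : J) (f : j ⟶ k), K.map f y = 0) :
    IsColimit c := by
  haveI : ReflectsColimit K (forget (ModuleCat.{u} A)) :=
    reflectsColimit_of_reflectsIsomorphisms _ _
  refine isColimitOfReflects (forget (ModuleCat.{u} A)) ?_
  refine Types.FilteredColimit.isColimitOf' _ _ ?_ ?_
  · intro x
    obtain ⟨j, y, h⟩ := hsurj x
    exact ⟨j, y, h.symm⟩
  · intro j x y hxy
    obtain ⟨k, f, h⟩ := hinj j ((show K.obj j from x) - (show K.obj j from y))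
      ((map_sub (c.ι.app j).hom _ _).trans (sub_eq_zero.2 hxy))
    exact ⟨k, f, sub_eq_zero.1 ((map_sub (K.map f).hom _ _).symm.trans h)⟩

theorem mainTheorem2 (R : Type u) [Ring R] (hR : IsRightCountablyCoherent R)
    (M : ModuleCat.{u} Rᵐᵒᵖ) (hM : IsFlatlyCoresolved R M) :
    ∃ (J : Type u) (_ : PartialOrder J) (P : ColimitPresentation J M),
      IsAlephOneDirected J ∧
      ∀ j : J, IsCountablyPresentable Rᵐᵒᵖ (P.diag.obj j) ∧
        IsFlatlyCoresolved R (P.diag.obj j) := by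
  obtain ⟨F, ε, d, hF, hε, hεd, hd⟩ := hM
  have hA := hR.hasCountablyGeneratedKernels
  have hπ (n) : Function.Surjective (Finsupp.linearCombination Rᵐᵒᵖ (id : F n → F n)) :=
    Finsupp.linearCombination_id_surjective _ _
  let SP := SubPresentation Rᵐᵒᵖ fun n => F n
  have hgood (j : SP) (hj : j.IsSmall) : ∃ j' : SP, j'.IsSmall ∧ j ≤ j' ∧ j'.Absorbs d j' :=
    hj.exists_absorbs_self fun j hj => hj.exists_absorbs hA hd fun n =>
      exists_lift_finset _ ((hF n).exists_lift _ (hπ n))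
  let J := {j : SP // j.IsSmall ∧ SubPresentation.Absorbs d j j}
  have hdir : IsAlephOneDirected J := by
    intro S hS
    have := hS.to_subtype
    obtain ⟨k, hk, hle, hk'⟩ := hgood (⨆ i : S, i.1.1)
      (SubPresentation.IsSmall.iSup fun i => i.1.2.1)
    exact ⟨⟨k, hk, hk'⟩, fun i hi => (le_iSup (fun i : S => i.1.1) ⟨i, hi⟩).trans hle⟩
  have hup (j : SP) (hj : j.IsSmall) : ∃ k : J, j ≤ k.1 := by
    obtain ⟨k, hk, hle, hk'⟩ := hgood j hj
    exact ⟨⟨k, hk, hk'⟩, hle⟩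
  have : Nonempty J := ⟨(hdir ∅ Set.countable_empty).choose⟩
  have : IsDirectedOrder J := ⟨fun a b => by
    obtain ⟨c, hc⟩ := hdir {a, b} (Set.toFinite _).countable
    exact ⟨c, hc (by simp), hc (by simp)⟩⟩
  let X (j : J) := Subquotient (SubPresentation.cocycles d j.1) (j.1 0).2
  let t {j k : J} (h : j ≤ k) : X j →ₗ[Rᵐᵒᵖ] X k := Subquotient.map LinearMap.id
    (SubPresentation.cocycles_mono h) (SubPresentation.snd_mono h 0)
  let K : J ⥤ ModuleCat.{u} Rᵐᵒᵖ :=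
    { obj j := ModuleCat.of Rᵐᵒᵖ (X j)
      map f := ModuleCat.ofHom (t (leOfHom f))
      map_id j := by
        ext
        rfl
      map_comp f g := by
        ext
        rfl }
  let φ (j : J) : X j →ₗ[Rᵐᵒᵖ] F 0 :=
    Subquotient.desc (Finsupp.linearCombination Rᵐᵒᵖ id) (j.2.1 0).2.2.2
  have hφ (j : J) (x : X j) : φ j x ∈ LinearMap.range ε := by
    obtain ⟨v, rfl⟩ := Subquotient.mk_surjective _ _ x
    refine (hεd _).1 ?_
    rw [Subquotient.desc_mk, ← SubPresentation.linearCombination_diff d]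
    exact (j.2.1 1).2.2.2 v.2.2
  -- Evaluation in `F 0` lands in `ker (d 0)`, the image of `ε`, so it factors uniquely through `M`.
  let ψ (j : J) : X j →ₗ[Rᵐᵒᵖ] M :=
    (LinearEquiv.ofInjective ε hε).symm.toLinearMap ∘ₗ (φ j).codRestrict _ (hφ j)
  have hψ (j : J) (x : X j) : ε (ψ j x) = φ j x :=
    congrArg Subtype.val
      ((LinearEquiv.ofInjective ε hε).apply_symm_apply ((φ j).codRestrict _ (hφ j) x))
  let c : Cocone K :=
    { pt := M
      ι :=
        { app j := ModuleCat.ofHom (ψ j)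
          naturality j k f := by
            ext x
            apply hε
            change ε (ψ k (t (leOfHom f) (Subquotient.mk _ _ x))) = ε (ψ j (Subquotient.mk _ _ x))
            rw [hψ, hψ]
            rfl } }
  have hc : IsColimit c := by
    refine ModuleCat.isColimitOfFiltered c (fun m => ?_) fun j y hy => ?_
    · obtain ⟨j, hj, hjm, -⟩ := SubPresentation.exists_isSmall_mem (A := Rᵐᵒᵖ)
        (F := fun n => F n) 0 (Set.countable_singleton (ε m)) Set.countable_empty (by simp)
      obtain ⟨k, hk⟩ := hup j hj
      -- The basis vector at `ε m` goes to the one at `d 0 (ε m) = 0`, a relation by `zero_rel`; so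
      -- it is a cocycle as soon as `ε m` is a generator.
      let v : SubPresentation.cocycles d k.1 := ⟨Finsupp.single (ε m) 1,
        Finsupp.single_mem_supported Rᵐᵒᵖ 1 (SubPresentation.fst_mono hk 0 (hjm rfl)), by
          simpa [hεd.apply_apply_eq_zero m] using k.2.2.zero_rel 1⟩
      refine ⟨k, Subquotient.mk _ _ v, hε ((hψ k _).trans ?_)⟩
      exact (Finsupp.linearCombination_single Rᵐᵒᵖ 1 (ε m)).trans (one_smul _ _)
    · obtain ⟨v, rfl⟩ := Subquotient.mk_surjective _ _ y
      have hv : Finsupp.linearCombination Rᵐᵒᵖ id v.1 = 0 := by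
        have := (hψ j _).symm.trans (congrArg ε hy)
        rwa [map_zero] at this
      -- A representative that evaluates to zero in `F 0` is itself an admissible relation, so
      -- adjoining it kills the class at a later index.
      obtain ⟨l, hl, -, hlv⟩ := SubPresentation.exists_isSmall_mem (A := Rᵐᵒᵖ)
        (F := fun n => F n) 0 Set.countable_empty (Set.countable_singleton v.1) (by simpa using hv)
      obtain ⟨k, hk⟩ := hup (j.1 ⊔ l) (j.2.1.sup hl)
      exact ⟨k, homOfLE (show j ≤ k from le_sup_left.trans hk),
        Subquotient.mk_eq_zero.2 (SubPresentation.snd_mono (le_sup_right.trans hk) 0 (hlv rfl))⟩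
  exact ⟨J, inferInstance, ⟨K, c.ι, hc⟩, hdir, fun j =>
    ⟨j.2.1.isCountablyPresentable_cocycles hA,
      j.2.2.isFlatlyCoresolved j.2.1 fun n => (hd n).apply_apply_eq_zero⟩⟩
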